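/- All topological spaces are assumed to be nonempty; no separation axiom is assumed. For cardinals $\lambda,\kappa\ge 1$ and for $\mu$ a nonzero cardinal or the symbol $\infty$ (larger than every cardinal), a space $X$ satisfies $R(\lambda,\mu;{<}\kappa)$ if for every sequence $(\mathcal U_\alpha)_{\alpha\in\lambda}$ of open covers of $X$ with $|\mathcal U_\alpha|\le\mu$ for all $\alpha$ (no restriction on cardinality if $\mu=\infty$) there are subsets $\mathcal V_\alpha\subseteq\mathcal U_\alpha$ with $|\mathcal V_\alpha|<\kappa$ for all $\alpha$ such that $\bigcup_{\alpha\in\lambda}\mathcal V_\alpha$ is a cover of $X$; and $R(\lambda,\mu;\kappa)$ means $R(\lambda,\mu;{<}\kappa^+)$. A space is $[\kappa,\mu]$-compact if each of its open covers of cardinality $\le\mu$ (each open cover, if $\mu=\infty$) has a subcover of cardinality $<\kappa$. Let $\kappa^{+0}=\kappa$ and $\kappa^{+n+1}=(\kappa^{+n})^+$. **Proposition 3.4.** Suppose that $\lambda$ and $\kappa$ are infinite cardinals, $\kappa$ is regular, $n\in\omega$, $\mu$ is either an infinite cardinal or $\infty$, and $\mu\ge\kappa^{+n+1}$. If a product $X=\prod_{j\in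 J}X_j$ of nonempty topological spaces, with the product topology, satisfies $R(\lambda,\mu;\kappa^{+n})$, then $$|\{\,j\in J : X_j \text{ is not } [\kappa,\mu]\text{-compact}\,\}|<\sup\{\lambda,\kappa^{+n+1}\}.$$ -/

import Mathlib

open Cardinal

universe u

/-- `𝒰` is an open cover of `X`: a set of open sets whose union is all of `X`. -/
def IsOpenCoverOf (X : Type u) [TopologicalSpace X] (𝒰 : Set (Set X)) : Prop :=
  (∀ U ∈ 𝒰, IsOpen U) ∧ ⋃₀ 𝒰 = Set.univ

/-- The generalized Rothberger property `R(l, μ; <κ)`: given `l` many open covers of `X`, each of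
cardinality at most `μ`, one can select from each of them fewer than `κ` members in such a way
that all the selected sets together cover `X`. The value `μ = ⊤` stands for `∞`, that is, no
restriction on the cardinality of the covers. -/
def RothbergerLT (l : Cardinal.{u}) (μ : WithTop Cardinal.{u}) (κ : Cardinal.{u})
    (X : Type u) [TopologicalSpace X] : Prop :=
  ∀ (ι : Type u), #ι = l → ∀ 𝒰 : ι → Set (Set X),
    (∀ a, IsOpenCoverOf X (𝒰 a)) → (∀ a, ((#(𝒰 a) : Cardinal.{u}) : WithTop Cardinal.{u}) ≤ μ) →
    ∃ 𝒱 : ι → Set (Set X), (∀ a, 𝒱 a ⊆ 𝒰 a) ∧ (∀ a, #(𝒱 a) < κ) ∧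
      ⋃₀ (⋃ a, 𝒱 a) = Set.univ

/-- `R(l, μ; κ)`, which is `R(l, μ; <κ⁺)`. -/
def Rothberger (l : Cardinal.{u}) (μ : WithTop Cardinal.{u}) (κ : Cardinal.{u})
    (X : Type u) [TopologicalSpace X] : Prop :=
  RothbergerLT l μ (Order.succ κ) X

/-- `[κ, μ]`-compactness: every open cover of cardinality at most `μ` has a subcover of
cardinality less than `κ`. For `μ = ⊤` (that is, `μ = ∞`) this is final `κ`-compactness. -/
def IntervalCompact (κ : Cardinal.{u}) (μ : WithTop Cardinal.{u})
    (X : Type u) [TopologicalSpace X] : Prop :=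
  ∀ 𝒰 : Set (Set X), IsOpenCoverOf X 𝒰 → ((#𝒰 : Cardinal.{u}) : WithTop Cardinal.{u}) ≤ μ →
    ∃ 𝒱 ⊆ 𝒰, #𝒱 < κ ∧ ⋃₀ 𝒱 = Set.univ

/-- The `n`-th iterated cardinal successor `κ^{+n}`. -/
noncomputable def iterSucc (κ : Cardinal.{u}) : ℕ → Cardinal.{u}
  | 0 => κ
  | n + 1 => Order.succ (iterSucc κ n)

open Set

/-! Too many bad factors would split into `l` disjoint blocks of `κ^{+(n+1)}` coordinates. If each
block carries a cover, depending only on its coordinates, with no subcover of size `≤ κ^{+n}`, then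
any selection misses a point on each block; these points glue to one uncovered point
(`not_rothbergerLT_of_pairwise_disjoint`). Such covers come from climbing one successor at a time
(`NotIntervalCompactOn.iUnion_succ`): `κ⁺` disjoint blocks bad for `κ` form a block bad for `κ⁺`.
The combinatorial input is `exists_locally_small_subadditive`. -/

theorem Cardinal.IsRegular.exists_forall_lt_of_mk_lt {c : Cardinal.{u}} (hc : c.IsRegular)
    (s : Set c.ord.ToType) (hs : #s < c) : ∃ b, ∀ x ∈ s, x < b := by
  by_contra! h
  have hcover : (⋃ x ∈ s, Iic x) = Set.univ := by
    refine eq_univ_of_forall fun b => ?_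
    obtain ⟨x, hx, hbx⟩ := h b
    exact mem_biUnion hx hbx
  have hlt : #(⋃ x ∈ s, Iic x : Set c.ord.ToType) < c := by
    rw [card_biUnion_lt_iff_forall_of_isRegular hc hs]
    intro x _
    refine (mk_Iic_lt x (by simp) (by simpa using hc.1)).trans_eq (by simp)
  rw [hcover, mk_univ, mk_ord_toType] at hlt
  exact hlt.false

theorem Cardinal.mk_Iic_toType_ord_lt {c : Cardinal.{u}} (hc : ℵ₀ ≤ c) (i : c.ord.ToType) :
    #(Iic i) < c :=
  (mk_Iic_lt i (by simp) (by simpa using hc)).trans_eq (by simp)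

/-- For regular `κ` there is a locally small function `ρ` on pairs from `κ⁺`, with values in `κ`,
satisfying one of the two subadditivity laws. -/
theorem exists_locally_small_subadditive {κ : Cardinal.{u}} (hκ : κ.IsRegular) :
    ∃ ρ : (Order.succ κ).ord.ToType → (Order.succ κ).ord.ToType → κ.ord.ToType,
      (∀ δ γ, #{α | α < δ ∧ ρ α δ ≤ γ} < κ) ∧
      ∀ α β δ, α < β → β < δ → ρ α β ≤ max (ρ α δ) (ρ β δ) := by
  have hinj : ∀ δ : (Order.succ κ).ord.ToType,
      ∃ g : (Order.succ κ).ord.ToType → κ.ord.ToType, InjOn g (Iio δ) := by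
    intro δ
    have h : #(Iio δ) ≤ #κ.ord.ToType := by
      rw [mk_ord_toType]
      exact Order.lt_succ_iff.1 ((mk_Iio_lt δ (by simp)).trans_eq (by simp))
    obtain ⟨f⟩ := h
    have : Nonempty κ.ord.ToType := nonempty_ord_toType hκ.ne_zero
    classical
    refine ⟨fun a => if ha : a < δ then f ⟨a, ha⟩ else Classical.arbitrary _, ?_⟩
    intro a ha b hb hab
    simp only [mem_Iio] at ha hb
    simp only [dif_pos ha, dif_pos hb] at hab
    exact congrArg Subtype.val (f.injective hab)
  choose g hg using hinj
  -- A total bounding function, arbitrary on large sets, lets the recursion be defined before its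
  -- value sets are known to be small.
  have hbd : ∀ s : Set κ.ord.ToType, ∃ b, #s < κ → ∀ x ∈ s, x < b := by
    intro s
    by_cases hs : #s < κ
    · obtain ⟨b, hb⟩ := hκ.exists_forall_lt_of_mk_lt s hs
      exact ⟨b, fun _ => hb⟩
    · have : Nonempty κ.ord.ToType := nonempty_ord_toType hκ.ne_zero
      exact ⟨Classical.arbitrary _, fun h => absurd h hs⟩
  choose bd hbd using hbd
  -- Exceeding `g δ α` gives local smallness. Of two points below `δ`, the one with larger `g δ`
  -- also dominates the value at the pair; both orders are included since either point may be the
  -- smaller.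
  let V (δ : (Order.succ κ).ord.ToType)
      (e : ∀ β, β < δ → (Order.succ κ).ord.ToType → κ.ord.ToType)
      (α : (Order.succ κ).ord.ToType) : Set κ.ord.ToType :=
    {g δ α} ∪ {v | ∃ β, ∃ hβ : β < δ, ∃ hα : α < δ, g δ β ≤ g δ α ∧ (v = e β hβ α ∨ v = e α hα β)}
  let e : (Order.succ κ).ord.ToType → (Order.succ κ).ord.ToType → κ.ord.ToType :=
    wellFounded_lt.fix fun δ e α => bd (V δ e α)
  have he : ∀ δ α, e δ α = bd (V δ (fun β _ => e β) α) := fun δ α =>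
    congrFun (wellFounded_lt.fix_eq (fun δ e α => bd (V δ e α)) δ) α
  have hpred : ∀ δ γ, #{β | β < δ ∧ g δ β ≤ γ} < κ := by
    intro δ γ
    refine lt_of_le_of_lt ?_ (mk_Iic_toType_ord_lt hκ.1 γ)
    refine mk_le_of_injective (f := fun β => ⟨g δ β.1, β.2.2⟩) ?_
    intro a b hab
    exact Subtype.ext (hg δ a.2.1 b.2.1 (congrArg Subtype.val hab))
  have hV : ∀ δ α, #(V δ (fun β _ => e β) α) < κ := by
    intro δ α
    have hsub : V δ (fun β _ => e β) α ⊆ {g δ α} ∪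
        ((fun β => e β α) '' {β | β < δ ∧ g δ β ≤ g δ α} ∪
          (fun β => e α β) '' {β | β < δ ∧ g δ β ≤ g δ α}) := by
      rintro v (hv | ⟨β, hβ, -, hle, rfl | rfl⟩)
      · exact Or.inl hv
      · exact Or.inr (Or.inl ⟨β, ⟨hβ, hle⟩, rfl⟩)
      · exact Or.inr (Or.inr ⟨β, ⟨hβ, hle⟩, rfl⟩)
    refine (mk_le_mk_of_subset hsub).trans_lt ((mk_union_le _ _).trans_lt ?_)
    refine add_lt_of_lt hκ.1 ?_ ((mk_union_le _ _).trans_lt (add_lt_of_lt hκ.1 ?_ ?_))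
    · rw [mk_singleton]
      exact one_lt_aleph0.trans_le hκ.1
    · exact mk_image_le.trans_lt (hpred _ _)
    · exact mk_image_le.trans_lt (hpred _ _)
  have hlt : ∀ δ α, ∀ v ∈ V δ (fun β _ => e β) α, v < e δ α := by
    intro δ α v hv
    rw [he]
    exact hbd _ (hV δ α) v hv
  refine ⟨fun α δ => e δ α, fun δ γ => ?_, fun α β δ hαβ hβδ => ?_⟩
  · refine (mk_le_mk_of_subset ?_).trans_lt (hpred δ γ)
    rintro α ⟨hα, hle⟩
    exact ⟨hα, (hlt δ α _ (Or.inl rfl)).le.trans hle⟩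
  · rcases le_total (g δ α) (g δ β) with h | h
    · exact le_max_of_le_right
        (hlt δ β _ (Or.inr ⟨α, hαβ.trans hβδ, hβδ, h, Or.inr rfl⟩)).le
    · exact le_max_of_le_left
        (hlt δ α _ (Or.inr ⟨β, hβδ, hαβ.trans hβδ, h, Or.inl rfl⟩)).le

/-- Missing points for disjoint sets of coordinates can be amalgamated. -/
theorem exists_agree_of_pairwise_disjoint {J T : Type*} {X : J → Type*}
    [∀ j, Nonempty (X j)] {A : T → Set J}
    (hA : Pairwise (Function.onFun Disjoint A)) (z : T → ∀ j, X j) :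
    ∃ x : ∀ j, X j, ∀ t, ∀ j ∈ A t, x j = z t j := by
  classical
  refine ⟨fun j => if h : ∃ t, j ∈ A t then z h.choose j else Classical.arbitrary _, ?_⟩
  intro t j hj
  have h : ∃ t, j ∈ A t := ⟨t, hj⟩
  have heq : h.choose = t := by
    by_contra hne
    exact disjoint_left.1 (hA hne) h.choose_spec hj
  simp only [dif_pos h]
  rw [heq]

/-- A set of cardinality at least `#T * #D` contains a `T`-indexed disjoint family of sets of
cardinality `#D`. -/
theorem exists_pairwise_disjoint_subset {J : Type u} {A : Set J} {T D : Type u} (h : #T * #D ≤ #A) :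
    ∃ B : T → Set J, Pairwise (Function.onFun Disjoint B) ∧ (∀ t, B t ⊆ A) ∧ ∀ t, #(B t) = #D := by
  rw [mul_def] at h
  obtain ⟨f⟩ := h
  refine ⟨fun t => range fun d => (f (t, d) : J), ?_, ?_, ?_⟩
  · intro t t' hne
    refine disjoint_left.2 ?_
    rintro _ ⟨d, rfl⟩ ⟨d', hd'⟩
    exact hne (congrArg Prod.fst (f.injective (Subtype.ext hd'))).symm
  · rintro t _ ⟨d, rfl⟩
    exact (f (t, d)).2
  · intro t
    refine mk_range_eq _ fun d d' hd => ?_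
    exact congrArg Prod.snd (f.injective (Subtype.ext hd))

/-- The product `∏ X j` has an open cover by sets depending only on the coordinates in `A`,
of cardinality at most `μ`, without a subcover of cardinality less than `κ`. -/
def NotIntervalCompactOn {J : Type u} (X : J → Type u) [∀ j, TopologicalSpace (X j)]
    (κ : Cardinal.{u}) (μ : WithTop Cardinal.{u}) (A : Set J) : Prop :=
  ∃ (I : Type u) (U : I → Set (∀ j, X j)), ((#I : Cardinal.{u}) : WithTop Cardinal.{u}) ≤ μ ∧
    (∀ i, IsOpen (U i)) ∧ (∀ i x y, (∀ j ∈ A, x j = y j) → x ∈ U i → y ∈ U i) ∧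
    (∀ x, ∃ i, x ∈ U i) ∧ ∀ S : Set I, #S < κ → ∃ x, ∀ i ∈ S, x ∉ U i

/-! ### Bad sets of coordinates and the successor step -/

section

variable {J : Type u} {X : J → Type u} [∀ j, TopologicalSpace (X j)]
  {κ : Cardinal.{u}} {μ : WithTop Cardinal.{u}}

theorem NotIntervalCompactOn.mono {A B : Set J} (h : NotIntervalCompactOn X κ μ A) (hAB : A ⊆ B) :
    NotIntervalCompactOn X κ μ B := by
  obtain ⟨I, U, hI, ho, hd, hc, hn⟩ := h
  exact ⟨I, U, hI, ho, fun i x y hxy => hd i x y fun j hj => hxy j (hAB hj), hc, hn⟩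

theorem notIntervalCompactOn_singleton [∀ j, Nonempty (X j)] {j : J}
    (h : ¬ IntervalCompact κ μ (X j)) : NotIntervalCompactOn X κ μ {j} := by
  simp only [IntervalCompact] at h
  push Not at h
  obtain ⟨𝒰, ⟨ho, hc⟩, hμ, hn⟩ := h
  refine ⟨𝒰, fun U => (fun x => x j) ⁻¹' U.1, hμ,
    fun U => (ho _ U.2).preimage (continuous_apply j), ?_, ?_, ?_⟩
  · intro U x y hxy hx
    simpa only [mem_preimage, ← hxy j rfl] using hx
  · intro x
    obtain ⟨U, hU, hx⟩ := (hc ▸ mem_univ (x j) : x j ∈ ⋃₀ 𝒰)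
    exact ⟨⟨U, hU⟩, hx⟩
  · intro S hS
    have hne := hn (Subtype.val '' S) (by rintro _ ⟨U, -, rfl⟩; exact U.2)
      (mk_image_le.trans_lt hS)
    obtain ⟨z, hz⟩ := (ne_univ_iff_exists_notMem _).1 hne
    classical
    refine ⟨Function.update (fun i => Classical.arbitrary (X i)) j z, fun U hU hmem => hz ?_⟩
    exact ⟨U, ⟨U, hU, rfl⟩, by simpa using hmem⟩

/-- A set of coordinates that is bad for `κ` but not for `κ⁺` carries an increasing open cover
indexed by `κ` that consists of proper subsets. -/
theorem NotIntervalCompactOn.exists_monotone_cover {A : Set J} (hκ : κ.IsRegular)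
    (h : NotIntervalCompactOn X κ μ A) (h' : ¬ NotIntervalCompactOn X (Order.succ κ) μ A) :
    ∃ O : κ.ord.ToType → Set (∀ j, X j), Monotone O ∧ (∀ γ, IsOpen (O γ)) ∧
      (∀ γ x y, (∀ j ∈ A, x j = y j) → x ∈ O γ → y ∈ O γ) ∧ (∀ x, ∃ γ, x ∈ O γ) ∧
      ∀ γ, ∃ x, x ∉ O γ := by
  obtain ⟨I, U, hI, ho, hd, hc, hn⟩ := h
  have hS : ∃ S : Set I, #S < Order.succ κ ∧ ∀ x, ∃ i ∈ S, x ∈ U i := by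
    by_contra! hS
    exact h' ⟨I, U, hI, ho, hd, hc, hS⟩
  obtain ⟨S, hSκ, hSc⟩ := hS
  rw [Order.lt_succ_iff, ← mk_ord_toType κ] at hSκ
  obtain ⟨f⟩ := hSκ
  refine ⟨fun γ => ⋃ i : {i : S // f i ≤ γ}, U i.1, ?_, fun γ => isOpen_iUnion fun i => ho _,
    ?_, ?_, ?_⟩
  · intro γ γ' hγ x hx
    obtain ⟨i, hi⟩ := mem_iUnion.1 hx
    exact mem_iUnion.2 ⟨⟨i.1, i.2.trans hγ⟩, hi⟩
  · intro γ x y hxy hx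
    obtain ⟨i, hi⟩ := mem_iUnion.1 hx
    exact mem_iUnion.2 ⟨i, hd _ x y hxy hi⟩
  · intro x
    obtain ⟨i, hi, hx⟩ := hSc x
    exact ⟨f ⟨i, hi⟩, mem_iUnion.2 ⟨⟨⟨i, hi⟩, le_rfl⟩, hx⟩⟩
  · intro γ
    have hlt : #((fun i : S => (i : I)) '' {i : S | f i ≤ γ}) < κ := by
      refine mk_image_le.trans_lt (lt_of_le_of_lt ?_ (mk_Iic_toType_ord_lt hκ.1 γ))
      refine mk_le_of_injective (f := fun i => ⟨f i.1, i.2⟩) ?_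
      intro a b hab
      exact Subtype.ext (f.injective (congrArg Subtype.val hab))
    obtain ⟨x, hx⟩ := hn _ hlt
    refine ⟨x, fun hmem => ?_⟩
    obtain ⟨i, hi⟩ := mem_iUnion.1 hmem
    exact hx _ ⟨i.1, i.2, rfl⟩ hi

/-- Unless some block is already bad for `κ⁺`, each has an increasing cover `O t` of length `κ`. The
sets `O α (ρ α β) ∩ O β (ρ α β)` for `α < β` cover by local smallness of `ρ`, and have no small
subcover by subadditivity. -/
theorem NotIntervalCompactOn.iUnion_succ [∀ j, Nonempty (X j)] (hκ : κ.IsRegular)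
    (hμ : ((Order.succ κ : Cardinal.{u}) : WithTop Cardinal.{u}) ≤ μ)
    {A : (Order.succ κ).ord.ToType → Set J} (hA : Pairwise (Function.onFun Disjoint A))
    (h : ∀ t, NotIntervalCompactOn X κ μ (A t)) :
    NotIntervalCompactOn X (Order.succ κ) μ (⋃ t, A t) := by
  by_cases hsucc : ∃ t, NotIntervalCompactOn X (Order.succ κ) μ (A t)
  · obtain ⟨t, ht⟩ := hsucc
    exact ht.mono (subset_iUnion A t)
  push Not at hsucc
  have hreg : (Order.succ κ).IsRegular := isRegular_succ hκ.1
  choose O hmono ho hd hc hn using fun t => (h t).exists_monotone_cover hκ (hsucc t)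
  obtain ⟨ρ, hsmall, hsub⟩ := exists_locally_small_subadditive hκ
  refine ⟨{p : (Order.succ κ).ord.ToType × (Order.succ κ).ord.ToType // p.1 < p.2},
    fun p => O p.1.1 (ρ p.1.1 p.1.2) ∩ O p.1.2 (ρ p.1.1 p.1.2), ?_, ?_, ?_, ?_, ?_⟩
  · refine le_trans (WithTop.coe_le_coe.2 ?_) hμ
    refine (mk_subtype_le _).trans ?_
    rw [← mul_def, mk_ord_toType, mul_eq_self hreg.1]
  · exact fun p => (ho _ _).inter (ho _ _)
  · rintro p x y hxy ⟨h₁, h₂⟩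
    exact ⟨hd _ _ x y (fun j hj => hxy j (mem_iUnion.2 ⟨_, hj⟩)) h₁,
      hd _ _ x y (fun j hj => hxy j (mem_iUnion.2 ⟨_, hj⟩)) h₂⟩
  · intro x
    choose γ hγ using fun t => hc t x
    obtain ⟨c, hcard⟩ := infinite_pigeonhole_card γ (Order.succ κ) (by simp) hreg.1
      (by rw [hreg.cof_ord, mk_ord_toType]; exact Order.lt_succ κ)
    obtain ⟨B, hB, hBκ⟩ := le_mk_iff_exists_subset.1 ((Order.le_succ κ).trans hcard)
    obtain ⟨b, hb⟩ := hreg.exists_forall_lt_of_mk_lt B (hBκ.trans_lt (Order.lt_succ κ))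
    obtain ⟨β, hβ, hbβ⟩ : ∃ β ∈ γ ⁻¹' {c}, b < β := by
      by_contra! hle
      exact ((mk_le_mk_of_subset (t := Iic b) hle).trans_lt
        (mk_Iic_toType_ord_lt hreg.1 b)).not_ge hcard
    -- `B` has `κ` points below `β`, too many for all to satisfy `ρ α β ≤ c`.
    obtain ⟨α, hα, hαc⟩ : ∃ α ∈ B, c < ρ α β := by
      by_contra! hle
      refine ((mk_le_mk_of_subset ?_).trans_lt (hsmall β c)).not_ge hBκ.ge
      exact fun α hα => ⟨(hb α hα).trans hbβ, hle α hα⟩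
    refine ⟨⟨(α, β), (hb α hα).trans hbβ⟩, ?_, ?_⟩
    · exact hmono α (((hB hα : γ α = c).le).trans hαc.le) (hγ α)
    · exact hmono β ((hβ : γ β = c).le.trans hαc.le) (hγ β)
  · intro S hS
    obtain ⟨δ, hδ⟩ := hreg.exists_forall_lt_of_mk_lt ((fun p => p.1.2) '' S)
      (mk_image_le.trans_lt hS)
    -- With `δ` above all indices in `S`, missing `O t (ρ t δ)` on every block rules out each pair:
    -- `ρ α β` is at most `ρ α δ` or `ρ β δ`.
    choose z hz using fun t => hn t (ρ t δ)
    obtain ⟨x, hx⟩ := exists_agree_of_pairwise_disjoint hA z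
    refine ⟨x, fun p hp hmem => ?_⟩
    have hpδ : p.1.2 < δ := hδ _ ⟨p, hp, rfl⟩
    rcases le_max_iff.1 (hsub _ _ _ p.2 hpδ) with hle | hle
    · exact hz _ (hd _ _ x _ (hx _) (hmono _ hle hmem.1))
    · exact hz _ (hd _ _ x _ (hx _) (hmono _ hle hmem.2))

end

/-! ### Iterated successors and the contradiction -/

theorem isRegular_iterSucc {κ : Cardinal.{u}} (hκ : κ.IsRegular) (n : ℕ) :
    (iterSucc κ n).IsRegular := by
  induction n with
  | zero => exact hκ
  | succ n ih => exact isRegular_succ ih.1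

theorem notIntervalCompactOn_iterSucc {J : Type u} {X : J → Type u} [∀ j, TopologicalSpace (X j)]
    [∀ j, Nonempty (X j)] {κ : Cardinal.{u}} {μ : WithTop Cardinal.{u}} (hκ : κ.IsRegular) (n : ℕ)
    (hμ : ((iterSucc κ n : Cardinal.{u}) : WithTop Cardinal.{u}) ≤ μ) {A : Set J}
    (hbad : ∀ j ∈ A, ¬ IntervalCompact κ μ (X j)) (hA : iterSucc κ n ≤ #A) :
    NotIntervalCompactOn X (iterSucc κ n) μ A := by
  induction n generalizing A with
  | zero =>
    have hne : #A ≠ 0 := (hκ.pos.trans_le hA).ne'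
    obtain ⟨j, hj⟩ := mk_ne_zero_iff.1 hne
    exact (notIntervalCompactOn_singleton (hbad j hj)).mono (singleton_subset_iff.2 hj)
  | succ n ih =>
    have hreg := isRegular_iterSucc hκ n
    have hle : iterSucc κ n ≤ iterSucc κ (n + 1) := Order.le_succ _
    obtain ⟨B, hdisj, hBA, hB⟩ := exists_pairwise_disjoint_subset (A := A)
      (T := (Order.succ (iterSucc κ n)).ord.ToType) (D := (iterSucc κ n).ord.ToType) (by
        rw [mk_ord_toType, mk_ord_toType]
        exact (mul_eq_left (hreg.1.trans hle) hle hreg.ne_zero).trans_le hA)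
    refine NotIntervalCompactOn.mono ?_ (iUnion_subset hBA)
    refine NotIntervalCompactOn.iUnion_succ hreg hμ hdisj fun t => ?_
    exact ih ((WithTop.coe_le_coe.2 hle).trans hμ) (fun j hj => hbad j (hBA t hj))
      (by rw [hB, mk_ord_toType])

theorem not_rothbergerLT_of_pairwise_disjoint {J : Type u} {X : J → Type u}
    [∀ j, TopologicalSpace (X j)] [∀ j, Nonempty (X j)] {κ : Cardinal.{u}}
    {μ : WithTop Cardinal.{u}} {T : Type u} {A : T → Set J}
    (hA : Pairwise (Function.onFun Disjoint A)) (h : ∀ t, NotIntervalCompactOn X κ μ (A t)) :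
    ¬ RothbergerLT #T μ κ (∀ j, X j) := by
  intro hR
  choose I U hI ho hd hc hn using h
  obtain ⟨𝒱, hsub, hcard, hcov⟩ := hR T rfl (fun t => range (U t))
    (fun t => ⟨by rintro _ ⟨i, rfl⟩; exact ho t i, eq_univ_of_forall fun x => by
      obtain ⟨i, hi⟩ := hc t x
      exact ⟨_, ⟨i, rfl⟩, hi⟩⟩)
    (fun t => (WithTop.coe_le_coe.2 mk_range_le).trans (hI t))
  -- Different indices may give the same set; one index per selected set keeps their number below
  -- `κ`.
  choose f hf using fun t (V : 𝒱 t) => hsub t V.2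
  choose z hz using fun t => hn t (range (f t)) (mk_range_le.trans_lt (hcard t))
  obtain ⟨x, hx⟩ := exists_agree_of_pairwise_disjoint hA z
  obtain ⟨V, hV, hxV⟩ := (hcov ▸ mem_univ x : x ∈ ⋃₀ (⋃ t, 𝒱 t))
  obtain ⟨t, ht⟩ := mem_iUnion.1 hV
  refine hz t (f t ⟨V, ht⟩) ⟨_, rfl⟩ (hd t _ x _ (hx t) ?_)
  rw [hf]
  exact hxV

theorem proposition3p4 (l κ : Cardinal.{u}) (hl : ℵ₀ ≤ l) (hκ : κ.IsRegular)
    (n : ℕ) (μ : WithTop Cardinal.{u})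
    (hμ : ((iterSucc κ (n + 1) : Cardinal.{u}) : WithTop Cardinal.{u}) ≤ μ)
    (J : Type u) (X : J → Type u) [∀ j, TopologicalSpace (X j)] [∀ j, Nonempty (X j)]
    (hX : Rothberger l μ (iterSucc κ n) (∀ j, X j)) :
    #{j : J | ¬ IntervalCompact κ μ (X j)} < max l (iterSucc κ (n + 1)) := by
  by_contra! hge
  have hreg := isRegular_iterSucc hκ (n + 1)
  obtain ⟨B, hdisj, hBA, hB⟩ := exists_pairwise_disjoint_subset
    (A := {j : J | ¬ IntervalCompact κ μ (X j)}) (T := l.ord.ToType)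
    (D := (iterSucc κ (n + 1)).ord.ToType) (by
      rw [mk_ord_toType, mk_ord_toType, mul_eq_max hl hreg.1]
      exact hge)
  refine not_rothbergerLT_of_pairwise_disjoint hdisj (fun t => ?_)
    (by rw [mk_ord_toType]; exact hX)
  exact notIntervalCompactOn_iterSucc hκ (n + 1) hμ (fun j hj => hBA t hj)
    (by rw [hB, mk_ord_toType])
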